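/- Let $K$ be a field, let $n\ge 3$ and $k\ge 1$ be integers, and let $S=K[x_1,\dots,x_n]$ with graded maximal ideal $\mathfrak m=(x_1,\dots,x_n)$. Let $C_n^k$ be the $k$-th power of the $n$-cycle, that is, the simple graph on $\{1,\dots,n\}$ in which two distinct vertices $i,j$ are adjacent if and only if $|i-j|\le k$ or $|i-j|\ge n-k$, and let $I(C_n^k)=(x_ix_j : \{i,j\}\in E(C_n^k))\subset S$ be its edge ideal. For a finitely generated nonzero graded $S$-module $M$, let $\operatorname{depth}(M)$ be the maximal length of an $M$-regular sequence with entries in $\mathfrak m$. Then $$\operatorname{depth}(S/I(C_n^k))=1\quad\text{if } n\le 2k+1,\qquad \operatorname{depth}(S/I(C_n^k))\ge\left\lceil\frac{n-k}{2k+1}\right\rceil\quad\text{if } n\ge 2k+2.$$ -/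

import Mathlib

/-- The `k`-th power of the cycle on `n` vertices: distinct vertices `i, j` are adjacent
iff `|i - j| ≤ k` or `|i - j| ≥ n - k`, i.e. iff their distance in the cycle is at most `k`
(for `n ≥ 3`). Vertices are numbered `0, …, n - 1` instead of `1, …, n`; the differences are
the same, and all arithmetic takes place in `ℤ`. -/
def cyclePower (n k : ℕ) : SimpleGraph (Fin n) where
  Adj i j := i ≠ j ∧
    (|(i : ℤ) - (j : ℤ)| ≤ (k : ℤ) ∨ (n : ℤ) - (k : ℤ) ≤ |(i : ℤ) - (j : ℤ)|)
  symm := ⟨fun i j h => ⟨h.1.symm, by rw [abs_sub_comm]; exact h.2⟩⟩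
  loopless := ⟨fun _ h => h.1 rfl⟩

/-- The edge ideal of a graph: the ideal generated by the monomials `x_i x_j`
with `{i, j}` an edge. -/
noncomputable def edgeIdeal (K : Type*) [Field K] {V : Type*} (G : SimpleGraph V) :
    Ideal (MvPolynomial V K) :=
  Ideal.span {f | ∃ i j : V, G.Adj i j ∧ f = MvPolynomial.X i * MvPolynomial.X j}

/-- The depth of a module `M` over the polynomial ring `S = K[x_v : v ∈ V]`: the supremum of the
lengths of the `M`-regular sequences with all entries in the graded maximal ideal
`𝔪 = (x_v : v ∈ V)`. -/
noncomputable def polyDepth (K : Type*) [Field K] (V : Type*) (M : Type*) [AddCommGroup M]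
    [Module (MvPolynomial V K) M] : ℕ∞ :=
  ⨆ (rs : List (MvPolynomial V K))
    (_ : (∀ r ∈ rs, r ∈ MvPolynomial.idealOfVars V K) ∧ RingTheory.Sequence.IsRegular M rs),
    (rs.length : ℕ∞)

/-! For the lower bounds, multiplication by `x` gives an exact sequence `0 → R ⧸ (J : x) → R ⧸ J → R
⧸ (J + (x)) → 0`, so any depth bound shared by both ends passes to the middle. For edge ideals and
`x = X v`, the right end deletes `v`; the left end deletes the neighbours of `v`, leaving `v` as a
free variable worth one unit of depth. Removing an initial run of vertices one by one cuts the cycle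
into an interval, and intervals into shorter ones, each unit of depth costing at most `2k + 1`
vertices. If `n ≤ 2k + 1` the graph is complete and the quotient is the coordinate ring of the union
of the axes. Modulo any nonzerodivisor in the maximal ideal this ring has a nonzero socle, so its
depth is at most one. -/

open CategoryTheory Abelian in
/-- Both ends of a short exact sequence bound the depth of the middle term. -/
theorem subsingleton_ext_of_shortExact {R : Type*} [CommRing R]
    (N : ModuleCat R) {T : ShortComplex (ModuleCat R)} (hT : T.ShortExact) (i : ℕ)
    (h₁ : Subsingleton (Ext N T.X₁ i)) (h₃ : Subsingleton (Ext N T.X₃ i)) :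
    Subsingleton (Ext N T.X₂ i) :=
  AddCommGrpCat.subsingleton_of_isZero <| ShortComplex.Exact.isZero_of_both_zeros
    (Ext.covariant_sequence_exact₂' N hT i)
    ((AddCommGrpCat.isZero_of_iff_subsingleton.mpr h₁).eq_zero_of_src _)
    ((AddCommGrpCat.isZero_of_iff_subsingleton.mpr h₃).eq_zero_of_tgt _)

/-! ### Depth, `Ext` and colon ideals -/

open RingTheory.Sequence

/-- There is an `R ⧸ J`-regular sequence of length `d` with entries in `m`. -/
def DepthGE {R : Type*} [CommRing R] (m J : Ideal R) (d : ℕ) : Prop :=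
  ∃ rs : List R, rs.length = d ∧ (∀ r ∈ rs, r ∈ m) ∧ IsRegular (R ⧸ J) rs

section
universe u
variable {R : Type u} [CommRing R]

theorem smul_top_quotient_lt {m J : Ideal R} (hm : m ≠ ⊤) (hJ : J ≤ m) :
    m • (⊤ : Submodule R (R ⧸ J)) < ⊤ := by
  refine lt_top_iff_ne_top.mpr fun h => hm ?_
  have h1 := congrArg (Submodule.comap (Submodule.mkQ J)) h
  rw [Submodule.comap_smul_top_of_surjective m _ (Submodule.mkQ_surjective _)] at h1
  simpa [hJ] using h1

theorem DepthGE.zero {m J : Ideal R} (hm : m ≠ ⊤) (hJ : J ≤ m) : DepthGE m J 0 := by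
  have : Nontrivial (R ⧸ J) := Ideal.Quotient.nontrivial_iff.mpr
    fun h => hm (top_le_iff.mp (h ▸ hJ))
  exact ⟨[], rfl, by simp, IsRegular.nil _ _⟩

open CategoryTheory Abelian in
-- Rees' criterion; vanishing of `Ext` is what can be chased through a long exact sequence.
theorem depthGE_iff_ext [IsNoetherianRing R] {m J : Ideal R} (hm : m ≠ ⊤) (hJ : J ≤ m) (d : ℕ) :
    DepthGE m J d ↔ ∀ i < d, Subsingleton
      (Ext (ModuleCat.of R (Shrink.{u} (R ⧸ m))) (ModuleCat.of R (R ⧸ J)) i) :=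
  ((ModuleCat.exists_isRegular_tfae m d (ModuleCat.of R (R ⧸ J))
    (smul_top_quotient_lt hm hJ)).out 1 3).symm

/-- Multiplication by `x` as a map `R ⧸ J' → R ⧸ J`. -/
noncomputable def quotientMulLeft (J J' : Ideal R) (x : R) (h : ∀ p ∈ J', x * p ∈ J) :
    (R ⧸ J') →ₗ[R] (R ⧸ J) :=
  Submodule.mapQ J' J (LinearMap.mulLeft R x) fun p hp => h p hp

open CategoryTheory Abelian in
theorem DepthGE.of_colon [IsNoetherianRing R] {m J J' : Ideal R} {x : R} (hm : m ≠ ⊤)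
    (hx : x ∈ m) (hJ : J ≤ m) (hJ' : J' ≤ m) (hcolon : ∀ p, x * p ∈ J ↔ p ∈ J') {d : ℕ}
    (h₁ : DepthGE m J' d) (h₃ : DepthGE m (J ⊔ Ideal.span {x}) d) : DepthGE m J d := by
  have hJx : J ⊔ Ideal.span {x} ≤ m := sup_le hJ ((Ideal.span_singleton_le_iff_mem m).mpr hx)
  rw [depthGE_iff_ext hm hJ'] at h₁
  rw [depthGE_iff_ext hm hJx] at h₃
  rw [depthGE_iff_ext hm hJ]
  intro i hi
  let f := quotientMulLeft J J' x fun p hp => (hcolon p).mpr hp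
  let g : (R ⧸ J) →ₗ[R] (R ⧸ (J ⊔ Ideal.span {x})) := Submodule.factor le_sup_left
  have hexact : Function.Exact f g := by
    intro y
    obtain ⟨y, rfl⟩ := Submodule.mkQ_surjective _ y
    constructor
    · intro h
      have h' : y ∈ J ⊔ Ideal.span {x} := (Submodule.Quotient.mk_eq_zero _).mp h
      obtain ⟨a, ha, b, hb, rfl⟩ := Submodule.mem_sup.mp h'
      obtain ⟨c, rfl⟩ := Ideal.mem_span_singleton'.mp hb
      refine ⟨Submodule.mkQ J' c, (Submodule.Quotient.eq _).mpr ?_⟩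
      have : LinearMap.mulLeft R x c - (a + c * x) = -a := by
        simp [mul_comm]
      rw [this]
      exact neg_mem ha
    · rintro ⟨z, hz⟩
      obtain ⟨z, rfl⟩ := Submodule.mkQ_surjective _ z
      rw [← hz]
      refine (Submodule.Quotient.mk_eq_zero _).mpr ?_
      exact Ideal.mul_mem_right _ _ (Ideal.mem_sup_right (Ideal.mem_span_singleton_self x))
  have hinj : Function.Injective f := by
    rw [← LinearMap.ker_eq_bot, LinearMap.ker_eq_bot']
    intro z hz
    obtain ⟨z, rfl⟩ := Submodule.mkQ_surjective _ z
    refine (Submodule.Quotient.mk_eq_zero _).mpr ((hcolon z).mp ?_)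
    exact (Submodule.Quotient.mk_eq_zero _).mp hz
  have hsurj : Function.Surjective g := Submodule.factor_surjective _
  let T : ShortComplex (ModuleCat.{u} R) :=
    ShortComplex.mk (ModuleCat.ofHom f) (ModuleCat.ofHom g) (by
      ext1; exact hexact.linearMap_comp_eq_zero)
  have hT : T.ShortExact :=
    { exact := (ShortComplex.ShortExact.moduleCat_exact_iff_function_exact T).mpr hexact
      mono_f := (ModuleCat.mono_iff_injective _).mpr hinj
      epi_g := (ModuleCat.epi_iff_surjective _).mpr hsurj }
  exact subsingleton_ext_of_shortExact _ hT i (h₁ i hi) (h₃ i hi)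

open Pointwise in
/-- `(R ⧸ J) ⧸ x (R ⧸ J)` is `R ⧸ (J + (x))`. -/
noncomputable def quotSMulTopQuotientEquiv (J : Ideal R) (x : R) :
    QuotSMulTop x (R ⧸ J) ≃ₗ[R] R ⧸ (J ⊔ Ideal.span {x}) :=
  (Submodule.quotEquivOfEq _ _ (by
    rw [← Submodule.ideal_span_singleton_smul, ← Submodule.range_mkQ J, ← Submodule.map_top,
      ← Submodule.map_smul'', smul_eq_mul, Ideal.mul_top])).trans (Submodule.quotientQuotientEquivQuotientSup J (Ideal.span {x}))

theorem DepthGE.succ_of_regular {m J : Ideal R} {x : R} (hx : x ∈ m)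
    (hreg : ∀ p, x * p ∈ J → p ∈ J) {d : ℕ}
    (h : DepthGE m (J ⊔ Ideal.span {x}) d) : DepthGE m J (d + 1) := by
  obtain ⟨rs, hl, hmem, hrs⟩ := h
  refine ⟨x :: rs, by simp [hl], by simpa [hx] using hmem, ?_⟩
  refine IsRegular.cons ?_ (((quotSMulTopQuotientEquiv J x).isRegular_congr rs).mpr hrs)
  rw [isSMulRegular_quotient_iff_mem_of_smul_mem]
  exact hreg

end

/-! ### Edge rings of induced subgraphs -/

section
universe u
variable (K : Type u) [Field K] {V : Type} (G : SimpleGraph V)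

open MvPolynomial

/-- The edge ideal of `G` plus the variables outside `W`; the quotient is the edge
ring `K[W] ⧸ I(G[W])` of the induced subgraph. -/
noncomputable def inducedEdgeIdeal (W : Set V) : Ideal (MvPolynomial V K) :=
  Ideal.span ((fun s => monomial s (1 : K)) ''
    {s | (∃ i j, G.Adj i j ∧ s = Finsupp.single i 1 + Finsupp.single j 1) ∨
      ∃ u ∉ W, s = Finsupp.single u 1})

variable {K G}

theorem mem_inducedEdgeIdeal {W : Set V} {p : MvPolynomial V K} :
    p ∈ inducedEdgeIdeal K G W ↔ ∀ s ∈ p.support,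
      (∃ i j, G.Adj i j ∧ s i ≠ 0 ∧ s j ≠ 0) ∨ ∃ u ∉ W, s u ≠ 0 := by
  rw [inducedEdgeIdeal, mem_ideal_span_monomial_image]
  refine forall₂_congr fun s _ => ?_
  constructor
  · rintro ⟨t, ⟨i, j, hij, rfl⟩ | ⟨u, hu, rfl⟩, hts⟩
    · refine Or.inl ⟨i, j, hij, ?_, ?_⟩
      · have := hts i
        simp at this
        omega
      · have := hts j
        simp at this
        omega
    · refine Or.inr ⟨u, hu, ?_⟩
      have := hts u
      simp at this
      omega
  · rintro (⟨i, j, hij, hi, hj⟩ | ⟨u, hu, hs⟩)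
    · refine ⟨_, Or.inl ⟨i, j, hij, rfl⟩, fun v => ?_⟩
      have hne := hij.ne
      by_cases h1 : i = v
      · subst h1
        simp [hne.symm]
        omega
      · by_cases h2 : j = v
        · subst h2
          simp [hne]
          omega
        · simp [h1, h2]
    · refine ⟨_, Or.inr ⟨u, hu, rfl⟩, fun v => ?_⟩
      by_cases h1 : u = v
      · subst h1
        simp
        omega
      · simp [h1]

theorem inducedEdgeIdeal_univ : inducedEdgeIdeal K G Set.univ = edgeIdeal K G := by
  rw [inducedEdgeIdeal, edgeIdeal]
  congr 1
  ext f
  constructor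
  · rintro ⟨s, ⟨i, j, hij, rfl⟩ | ⟨u, hu, rfl⟩, rfl⟩
    · exact ⟨i, j, hij, by simp [X, monomial_mul]⟩
    · simp at hu
  · rintro ⟨i, j, hij, rfl⟩
    exact ⟨_, Or.inl ⟨i, j, hij, rfl⟩, by simp [X, monomial_mul]⟩

theorem X_mem_idealOfVars (v : V) : (X v : MvPolynomial V K) ∈ idealOfVars V K :=
  Ideal.subset_span ⟨v, rfl⟩

theorem inducedEdgeIdeal_le (W : Set V) : inducedEdgeIdeal K G W ≤ idealOfVars V K := by
  rw [inducedEdgeIdeal, Ideal.span_le]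
  rintro _ ⟨s, ⟨i, j, hij, rfl⟩ | ⟨u, hu, rfl⟩, rfl⟩
  · have : monomial (Finsupp.single i 1 + Finsupp.single j 1) (1 : K) = X i * X j := by
      simp [X, monomial_mul]
    simp only [this]
    exact Ideal.mul_mem_right _ _ (Ideal.subset_span ⟨i, rfl⟩)
  · exact Ideal.subset_span ⟨u, rfl⟩

theorem inducedEdgeIdeal_sup_span_X {W : Set V} (v : V) :
    inducedEdgeIdeal K G W ⊔ Ideal.span {X v} = inducedEdgeIdeal K G (W \ {v}) := by
  have : ({X v} : Set (MvPolynomial V K)) =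
      (fun s => monomial s (1 : K)) '' {Finsupp.single v 1} := by rw [Set.image_singleton, X]
  rw [inducedEdgeIdeal, inducedEdgeIdeal, this, ← Ideal.span_union, ← Set.image_union]
  congr 2
  ext s
  simp only [Set.mem_union, Set.mem_ofPred_eq, Set.mem_singleton_iff, Set.mem_sdiff, not_and_or,
    not_not, or_assoc]
  refine or_congr_right ⟨?_, ?_⟩
  · rintro (⟨u, hu, rfl⟩ | rfl)
    exacts [⟨u, Or.inl hu, rfl⟩, ⟨v, Or.inr rfl, rfl⟩]
  · rintro ⟨u, hu | rfl, rfl⟩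
    exacts [Or.inl ⟨u, hu, rfl⟩, Or.inr rfl]

/-- Dividing the generators `X v * X u` by `X v` turns each neighbour `u` into a generator, which
amounts to removing it from `W`. -/
theorem X_mul_mem_inducedEdgeIdeal {W : Set V} {v : V} (hv : v ∈ W) (p : MvPolynomial V K) :
    X v * p ∈ inducedEdgeIdeal K G W ↔ p ∈ inducedEdgeIdeal K G (W \ G.neighborSet v) := by
  simp only [mem_inducedEdgeIdeal, support_X_mul, Finset.mem_map, forall_exists_index, and_imp,
    forall_apply_eq_imp_iff₂]
  refine forall₂_congr fun s _ => ?_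
  have key : ∀ u, (addLeftEmbedding (Finsupp.single v 1) s) u ≠ 0 ↔ u = v ∨ s u ≠ 0 := by
    intro u
    by_cases h : u = v
    · subst h; simp
    · simp [h]
  simp only [key, Set.mem_sdiff, SimpleGraph.mem_neighborSet, not_and_or, not_not]
  constructor
  · rintro (⟨i, j, hij, rfl | hi, rfl | hj⟩ | ⟨u, hu, rfl | hs⟩)
    · exact absurd rfl hij.ne
    · exact Or.inr ⟨j, Or.inr hij, hj⟩
    · exact Or.inr ⟨i, Or.inr hij.symm, hi⟩
    · exact Or.inl ⟨i, j, hij, hi, hj⟩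
    · exact absurd hv hu
    · exact Or.inr ⟨u, Or.inl hu, hs⟩
  · rintro (⟨i, j, hij, hi, hj⟩ | ⟨u, hu | hu, hs⟩)
    · exact Or.inl ⟨i, j, hij, Or.inr hi, Or.inr hj⟩
    · exact Or.inr ⟨u, hu, Or.inr hs⟩
    · exact Or.inl ⟨v, u, hu, Or.inl rfl, Or.inr hs⟩

theorem idealOfVars_ne_top : idealOfVars V K ≠ ⊤ := by
  intro h
  have h1 : idealOfVars V K ≤ RingHom.ker (constantCoeff (R := K) (σ := V)) := by
    rw [idealOfVars, Ideal.span_le]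
    rintro _ ⟨i, rfl⟩
    simp
  rw [h, top_le_iff] at h1
  exact RingHom.ker_ne_top _ h1

variable (K G) in
/-- The edge ring of the subgraph of `G` induced on `W` has depth at least `d`. -/
def EdgeDepthGE (W : Set V) (d : ℕ) : Prop :=
  DepthGE (idealOfVars V K) (inducedEdgeIdeal K G W) d

theorem EdgeDepthGE.zero (W : Set V) : EdgeDepthGE K G W 0 :=
  DepthGE.zero idealOfVars_ne_top (inducedEdgeIdeal_le W)

theorem EdgeDepthGE.succ_of_isolated {W : Set V} {v : V} (hv : v ∈ W)
    (hiso : ∀ u ∈ W, ¬ G.Adj v u) {d : ℕ} (h : EdgeDepthGE K G (W \ {v}) d) :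
    EdgeDepthGE K G W (d + 1) := by
  refine DepthGE.succ_of_regular (x := X v) (X_mem_idealOfVars v) (fun p hp => ?_) ?_
  · rw [X_mul_mem_inducedEdgeIdeal hv] at hp
    have hW : W \ G.neighborSet v = W :=
      sdiff_eq_left.mpr (Set.disjoint_left.mpr fun u hu => hiso u hu)
    rwa [hW] at hp
  · rwa [inducedEdgeIdeal_sup_span_X]

/-- The recursion behind all lower bounds: `h₂` may ask for one less because `v` is isolated once
its neighbours are gone. -/
theorem EdgeDepthGE.succ_of_delete [Finite V] {W : Set V} {v : V} (hv : v ∈ W) {d : ℕ}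
    (h₁ : EdgeDepthGE K G (W \ {v}) (d + 1))
    (h₂ : EdgeDepthGE K G ((W \ G.neighborSet v) \ {v}) d) : EdgeDepthGE K G W (d + 1) := by
  refine DepthGE.of_colon (x := X v) (J' := inducedEdgeIdeal K G (W \ G.neighborSet v))
    idealOfVars_ne_top (X_mem_idealOfVars v)
    (inducedEdgeIdeal_le _) (inducedEdgeIdeal_le _) (X_mul_mem_inducedEdgeIdeal hv) ?_ ?_
  · exact EdgeDepthGE.succ_of_isolated (W := W \ G.neighborSet v) ⟨hv, by simp⟩ (fun u hu => hu.2) h₂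
  · rwa [inducedEdgeIdeal_sup_span_X]

theorem EdgeDepthGE.one_of_nonempty [Finite V] {W : Set V} (hW : W.Nonempty) :
    EdgeDepthGE K G W 1 := by
  induction W, W.toFinite using Set.Finite.induction_on with
  | empty => simp at hW
  | @insert v W hv _ ih =>
    have hdiff : insert v W \ {v} = W := by simp [hv]
    rcases W.eq_empty_or_nonempty with rfl | hne
    · exact EdgeDepthGE.succ_of_isolated (v := v) (by simp) (by simp) (EdgeDepthGE.zero _)
    · exact EdgeDepthGE.succ_of_delete (v := v) (by simp) (by rw [hdiff]; exact ih hne)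
        (EdgeDepthGE.zero _)

theorem EdgeDepthGE.le_polyDepth {d : ℕ} (h : EdgeDepthGE K G Set.univ d) :
    (d : ℕ∞) ≤ polyDepth K V (MvPolynomial V K ⧸ edgeIdeal K G) := by
  rw [EdgeDepthGE, inducedEdgeIdeal_univ] at h
  obtain ⟨rs, rfl, hm, hr⟩ := h
  exact le_iSup₂_of_le rs ⟨hm, hr⟩ le_rfl

end

/-! ### Lower bound for powers of cycles -/

section
universe u
variable {K : Type u} [Field K] {n k : ℕ}

/-- The vertices of `Fin n` in `[a, b)`. -/
def finSegment (n a b : ℕ) : Set (Fin n) := {i | a ≤ (i : ℕ) ∧ (i : ℕ) < b}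

theorem cyclePower_adj_iff {i j : Fin n} (h : (i : ℕ) < j) :
    (cyclePower n k).Adj i j ↔ (j : ℕ) ≤ i + k ∨ n + i ≤ j + k := by
  have hne : i ≠ j := by rintro rfl; omega
  have habs : |(i : ℤ) - (j : ℤ)| = j - i := by rw [abs_sub_comm, abs_of_pos]; omega
  simp only [cyclePower, ne_eq, hne, not_false_eq_true, true_and, habs]
  omega

/-- A run of `ℓ` consecutive vertices without wrap-around has depth at least `⌈ℓ / (2k + 1)⌉`. -/
theorem edgeDepthGE_finSegment (d a b : ℕ) (hb : b ≤ n) (hab : b + k ≤ n + a)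
    (hd : a + d * (2 * k + 1) < b + (2 * k + 1)) :
    EdgeDepthGE K (cyclePower n k) (finSegment n a b) d := by
  induction d generalizing a b with
  | zero => exact EdgeDepthGE.zero _
  | succ d ih =>
    rw [add_one_mul] at hd
    have ha : a < n := by omega
    let s : Fin n := ⟨a, ha⟩
    -- The neighbours `a + 1, …, a + k` of `s` are deleted in increasing order; `j` of them are
    -- still to be treated.
    have key : ∀ j, j ≤ k → EdgeDepthGE K (cyclePower n k)
        (insert s (finSegment n (a + (k - j) + 1) b)) (d + 1) := by
      intro j
      induction j with
      | zero =>
        intro _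
        refine EdgeDepthGE.succ_of_isolated (v := s) (Set.mem_insert _ _) ?_ ?_
        · rintro u (rfl | ⟨hu1, hu2⟩)
          · exact SimpleGraph.irrefl _
          · have : (s : ℕ) = a := rfl
            rw [cyclePower_adj_iff (by omega)]
            omega
        · have : insert s (finSegment n (a + (k - 0) + 1) b) \ {s} =
              finSegment n (a + k + 1) b := by
            ext u
            have : (s : ℕ) = a := rfl
            simp only [finSegment, Set.mem_sdiff, Set.mem_insert_iff, Set.mem_singleton_iff,
              Set.mem_ofPred_eq, Fin.ext_iff]
            omega
          rw [this]
          exact ih _ _ hb (by omega) (by omega)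
      | succ j ihj =>
        intro hj
        by_cases hv : a + (k - (j + 1)) + 1 < b
        · let v : Fin n := ⟨a + (k - (j + 1)) + 1, by omega⟩
          have hs : (s : ℕ) = a := rfl
          have hvv : (v : ℕ) = a + (k - (j + 1)) + 1 := rfl
          refine EdgeDepthGE.succ_of_delete (v := v) (Or.inr ⟨le_rfl, hv⟩) ?_ ?_
          · convert ihj (by omega) using 1
            ext u
            simp only [finSegment, Set.mem_sdiff, Set.mem_insert_iff, Set.mem_singleton_iff,
              Set.mem_ofPred_eq, Fin.ext_iff]
            omega
          -- Since `v ≤ a + k`, `s` is also a neighbour of `v`; what survives starts at `v + k + 1 ≤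
          -- a + 2k + 1`.
          · convert ih (a + (k - (j + 1)) + 1 + k + 1) b hb (by omega) (by omega) using 1
            ext u
            simp only [finSegment, Set.mem_sdiff, Set.mem_insert_iff, Set.mem_singleton_iff,
              Set.mem_ofPred_eq, SimpleGraph.mem_neighborSet]
            rcases lt_trichotomy (u : ℕ) v with h | h | h
            · rw [SimpleGraph.adj_comm, cyclePower_adj_iff h, Fin.ext_iff, Fin.ext_iff]
              omega
            · rw [Fin.ext_iff, Fin.ext_iff]
              omega
            · rw [cyclePower_adj_iff h, Fin.ext_iff, Fin.ext_iff]
              omega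
        · convert ihj (by omega) using 2
          ext u
          simp only [finSegment, Set.mem_ofPred_eq]
          omega
    convert key k le_rfl using 1
    ext u
    have : (s : ℕ) = a := rfl
    simp only [finSegment, Set.mem_insert_iff, Set.mem_ofPred_eq, Fin.ext_iff]
    omega

theorem edgeDepthGE_cyclePower_univ {d : ℕ} (hn : 2 * k + 2 ≤ n) (hd : d * (2 * k + 1) + k < n) :
    EdgeDepthGE K (cyclePower n k) Set.univ (d + 1) := by
  -- Deleting `0, …, k - 1` in turn leaves `n - k` consecutive vertices, too few to wrap around.
  have key : ∀ j, j ≤ k →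
      EdgeDepthGE K (cyclePower n k) (finSegment n (k - j) n) (d + 1) := by
    intro j
    induction j with
    | zero =>
      intro _
      exact edgeDepthGE_finSegment _ _ _ le_rfl (by omega) (by rw [add_one_mul]; omega)
    | succ j ihj =>
      intro hj
      let v : Fin n := ⟨k - (j + 1), by omega⟩
      have hvv : (v : ℕ) = k - (j + 1) := rfl
      refine EdgeDepthGE.succ_of_delete (W := finSegment n (k - (j + 1)) n) (v := v)
        ⟨le_rfl, by omega⟩ ?_ ?_
      · convert ihj (by omega) using 1
        ext u
        simp only [finSegment, Set.mem_sdiff, Set.mem_singleton_iff,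
          Set.mem_ofPred_eq, Fin.ext_iff]
        omega
      -- The neighbours of `v` across the wrap-around, from `n + v - k` on, disappear too.
      · convert edgeDepthGE_finSegment (K := K) (n := n) (k := k) d (v + k + 1) (n + v - k)
          (by omega) (by omega) (by omega) using 1
        ext u
        simp only [finSegment, Set.mem_sdiff, Set.mem_singleton_iff,
          Set.mem_ofPred_eq, SimpleGraph.mem_neighborSet]
        rcases lt_trichotomy (u : ℕ) v with h | h | h
        · rw [SimpleGraph.adj_comm, cyclePower_adj_iff h, Fin.ext_iff]
          omega
        · rw [Fin.ext_iff]
          omega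
        · rw [cyclePower_adj_iff h, Fin.ext_iff]
          omega
  convert key k le_rfl using 1
  ext u
  simp [finSegment]

theorem cyclePower_eq_top (h : n ≤ 2 * k + 1) : cyclePower n k = ⊤ := by
  ext i j
  rw [SimpleGraph.top_adj]
  rcases lt_trichotomy (i : ℕ) j with hij | hij | hij
  · rw [cyclePower_adj_iff hij, ne_eq, Fin.ext_iff]
    omega
  · obtain rfl := Fin.ext hij
    simp
  · rw [SimpleGraph.adj_comm, cyclePower_adj_iff hij, ne_eq, Fin.ext_iff]
    omega

/-! ### Complete graphs: upper bound by a socle element -/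

open MvPolynomial

/-- Restriction of polynomials to the `i`-th coordinate axis. -/
noncomputable def axisEval (K : Type u) [Field K] {V : Type} [DecidableEq V] (i : V) :
    MvPolynomial V K →ₐ[K] Polynomial K :=
  aeval fun j => if j = i then Polynomial.X else 0

section
variable {V : Type} [DecidableEq V]

theorem axisEval_X_self (i : V) : axisEval K i (X i) = Polynomial.X := by
  simp [axisEval]

theorem axisEval_X_of_ne {i j : V} (h : j ≠ i) : axisEval K i (X j) = 0 := by
  simp [axisEval, h]

theorem coeff_zero_axisEval (i : V) (p : MvPolynomial V K) :
    (axisEval K i p).coeff 0 = constantCoeff p := by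
  have : (Polynomial.constantCoeff.comp (axisEval K i).toRingHom) = constantCoeff := by
    refine MvPolynomial.ringHom_ext (fun r => ?_) fun j => ?_
    · simp [axisEval]
    · by_cases h : j = i <;> simp [axisEval, h]
  exact RingHom.congr_fun this p

theorem axisEval_eq_zero_of_mem {i : V} {p : MvPolynomial V K}
    (h : p ∈ edgeIdeal K (⊤ : SimpleGraph V)) :
    axisEval K i p = 0 := by
  have : edgeIdeal K (⊤ : SimpleGraph V) ≤ RingHom.ker (axisEval K i) := by
    rw [edgeIdeal, Ideal.span_le]
    rintro _ ⟨a, b, hab, rfl⟩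
    rw [SetLike.mem_coe, RingHom.mem_ker, map_mul]
    by_cases ha : a = i
    · rw [axisEval_X_of_ne (j := b) (by rintro rfl; exact hab.ne ha), mul_zero]
    · rw [axisEval_X_of_ne ha, zero_mul]
  exact this h

/-- The difference lies in the ideal of the other variables, and `X i` times each of these is an
edge. -/
theorem X_mul_sub_aeval_axisEval_mem (i : V) (p : MvPolynomial V K) :
    X i * (p - Polynomial.aeval (X i) (axisEval K i p)) ∈ edgeIdeal K (⊤ : SimpleGraph V) := by
  set J : Ideal (MvPolynomial V K) := Ideal.span (X '' {j | j ≠ i})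
  have h : p - Polynomial.aeval (X i) (axisEval K i p) ∈ J := by
    have : (Ideal.Quotient.mkₐ K J) =
        (Ideal.Quotient.mkₐ K J).comp ((Polynomial.aeval (X i)).comp (axisEval K i)) := by
      refine MvPolynomial.algHom_ext fun j => ?_
      by_cases hj : j = i
      · simp [axisEval, hj]
      · simp only [AlgHom.comp_apply, axisEval_X_of_ne hj, map_zero]
        exact Ideal.Quotient.eq_zero_iff_mem.mpr (Ideal.subset_span ⟨j, hj, rfl⟩)
    exact (Ideal.Quotient.eq).mp (AlgHom.congr_fun this p)
  have hJ : J ≤ Submodule.comap (LinearMap.mulLeft (MvPolynomial V K) (X i))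
      (edgeIdeal K (⊤ : SimpleGraph V)) := by
    rw [Ideal.span_le]
    rintro _ ⟨j, hj, rfl⟩
    exact Ideal.subset_span ⟨i, j, Ne.symm hj, rfl⟩
  exact hJ h

theorem X_mul_mem_of_axisEval_eq_zero {i : V} {p : MvPolynomial V K} (h : axisEval K i p = 0) :
    X i * p ∈ edgeIdeal K (⊤ : SimpleGraph V) := by
  simpa [h] using X_mul_sub_aeval_axisEval_mem i p

theorem X_not_mem_edgeIdeal_top (i : V) :
    (X i : MvPolynomial V K) ∉ edgeIdeal K (⊤ : SimpleGraph V) := fun h =>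
  Polynomial.X_ne_zero ((axisEval_X_self (K := K) i).symm.trans (axisEval_eq_zero_of_mem h))

/-- For `f` a nonzerodivisor modulo the edge ideal of a complete graph, the maximal ideal
consists of zero divisors modulo `(f)`. -/
theorem exists_socle_edgeIdeal_top [Nontrivial V] {f : MvPolynomial V K} (hf : f ∈ idealOfVars V K)
    (hreg : ∀ p, f * p ∈ edgeIdeal K (⊤ : SimpleGraph V) → p ∈ edgeIdeal K (⊤ : SimpleGraph V)) :
    ∃ u ∉ edgeIdeal K (⊤ : SimpleGraph V) ⊔ Ideal.span {f},
      ∀ r ∈ idealOfVars V K, r * u ∈ edgeIdeal K (⊤ : SimpleGraph V) ⊔ Ideal.span {f} := by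
  obtain ⟨a, b, hab⟩ := exists_pair_ne V
  have hne : ∀ i, axisEval K i f ≠ 0 := fun i h =>
    X_not_mem_edgeIdeal_top i (hreg _ (by rw [mul_comm]; exact X_mul_mem_of_axisEval_eq_zero h))
  have hf0 : constantCoeff f = 0 := by
    have : idealOfVars V K ≤ RingHom.ker (constantCoeff (R := K) (σ := V)) := by
      rw [idealOfVars, Ideal.span_le]
      rintro _ ⟨i, rfl⟩
      simp
    exact this hf
  obtain ⟨q, hq⟩ : (Polynomial.X : Polynomial K) ∣ axisEval K a f := by
    rw [Polynomial.X_dvd_iff, coeff_zero_axisEval, hf0]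
  -- The candidate socle element is the part of `f` on axis `a`: it vanishes on every other axis,
  -- and `X a * u` agrees with `X a * f`.
  set u : MvPolynomial V K := Polynomial.aeval (X a) (axisEval K a f) with hu
  have huX : u = X a * Polynomial.aeval (X a) q := by rw [hu, hq, map_mul, Polynomial.aeval_X]
  refine ⟨u, fun hmem => ?_, fun r hr => ?_⟩
  · obtain ⟨c, hc, w, hw, hcw⟩ := Submodule.mem_sup.mp hmem
    obtain ⟨g, rfl⟩ := Ideal.mem_span_singleton'.mp hw
    have hua : axisEval K a u = axisEval K a f := by
      rw [hu, ← Polynomial.aeval_algHom_apply, axisEval_X_self, Polynomial.aeval_X_left_apply]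
    have hub : axisEval K b u = 0 := by rw [huX, map_mul, axisEval_X_of_ne hab, zero_mul]
    rw [← hcw, map_add, axisEval_eq_zero_of_mem hc, zero_add, map_mul] at hua hub
    -- If `u = g * f` modulo edges, `g` is 1 on axis `a` and 0 on axis `b`, which is impossible at
    -- the origin.
    have h1 : axisEval K a g = 1 := mul_right_cancel₀ (hne a) (by rw [hua, one_mul])
    have h2 : axisEval K b g = 0 := (mul_eq_zero.mp hub).resolve_right (hne b)
    have h3 := coeff_zero_axisEval a g
    rw [← coeff_zero_axisEval b g, h1, h2] at h3
    simp at h3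
  · have : idealOfVars V K ≤ Submodule.comap (LinearMap.mulRight (MvPolynomial V K) u)
        (edgeIdeal K (⊤ : SimpleGraph V) ⊔ Ideal.span {f}) := by
      rw [idealOfVars, Ideal.span_le]
      rintro _ ⟨i, rfl⟩
      change X i * u ∈ edgeIdeal K (⊤ : SimpleGraph V) ⊔ Ideal.span {f}
      by_cases hi : i = a
      · subst hi
        have h1 := X_mul_sub_aeval_axisEval_mem i f
        have h2 : X i * u = X i * f - X i * (f - u) := by ring
        rw [h2]
        exact sub_mem (Ideal.mul_mem_left _ _ (Ideal.mem_sup_right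
          (Ideal.mem_span_singleton_self f))) (Ideal.mem_sup_left h1)
      · rw [huX, ← mul_assoc]
        exact Ideal.mem_sup_left (Ideal.mul_mem_right _ _ (Ideal.subset_span ⟨i, a, hi, rfl⟩))
    exact this hr

theorem polyDepth_edgeIdeal_top_le_one [Nontrivial V] :
    polyDepth K V (MvPolynomial V K ⧸ edgeIdeal K (⊤ : SimpleGraph V)) ≤ 1 := by
  refine iSup₂_le fun rs hrs => ?_
  obtain ⟨hm, hr⟩ := hrs
  match rs with
  | [] => simp
  | [_] => simp
  | f :: r :: rs =>
    exfalso
    simp only [List.mem_cons, forall_eq_or_imp] at hm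
    have h := (RingTheory.Sequence.isWeaklyRegular_cons_iff _ _ _).mp hr.toIsWeaklyRegular
    obtain ⟨u, hu, hmu⟩ := exists_socle_edgeIdeal_top hm.1
      ((isSMulRegular_quotient_iff_mem_of_smul_mem _ _).mp h.1)
    have h' := (((quotSMulTopQuotientEquiv _ f).isWeaklyRegular_congr _).mp h.2)
    have h'' := ((RingTheory.Sequence.isWeaklyRegular_cons_iff _ _ _).mp h').1
    exact hu ((isSMulRegular_quotient_iff_mem_of_smul_mem _ _).mp h'' u (hmu r hm.2.1))

end
end

theorem theorem4p4 (K : Type*) [Field K] (n k : ℕ) (hn : 3 ≤ n) (hk : 1 ≤ k) :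
    (n ≤ 2 * k + 1 →
      polyDepth K (Fin n) (MvPolynomial (Fin n) K ⧸ edgeIdeal K (cyclePower n k)) = 1) ∧
    (2 * k + 2 ≤ n →
      ((⌈((n : ℚ) - (k : ℚ)) / (2 * (k : ℚ) + 1)⌉₊ : ℕ) : ℕ∞) ≤
        polyDepth K (Fin n) (MvPolynomial (Fin n) K ⧸ edgeIdeal K (cyclePower n k))) := by
  have : Nontrivial (Fin n) := Fin.nontrivial_iff_two_le.mpr (by omega)
  refine ⟨fun h => le_antisymm ?_ ?_, fun h => ?_⟩
  · rw [cyclePower_eq_top h]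
    exact polyDepth_edgeIdeal_top_le_one
  · exact_mod_cast (EdgeDepthGE.one_of_nonempty Set.univ_nonempty).le_polyDepth
  · rcases hd : ⌈((n : ℚ) - (k : ℚ)) / (2 * (k : ℚ) + 1)⌉₊ with _ | d
    · simp
    · have h1 : (d : ℚ) < ((n : ℚ) - (k : ℚ)) / (2 * (k : ℚ) + 1) :=
        Nat.lt_ceil.mp (by omega)
      rw [lt_div_iff₀ (by positivity), lt_sub_iff_add_lt] at h1
      exact (edgeDepthGE_cyclePower_univ h (by exact_mod_cast h1)).le_polyDepth
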